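/- Let $n\in\mathbb{N}$, let $m_1,m_2\in\mathbb{R}^n$, let $M_1,M_2\in\mathbb{R}^{n\times n}$ be symmetric positive semidefinite, and let $P,Q,R\in\mathbb{R}^{n\times n}$ be symmetric. Let $\mathbb{P}_1=N(m_1,M_1)$ and $\mathbb{P}_2=N(m_2,M_2)$ be the (possibly degenerate) Gaussian measures on $\mathbb{R}^n$ with these means and covariance matrices, and let $\Pi(\mathbb{P}_1,\mathbb{P}_2)$ be the set of Borel probability measures on $\mathbb{R}^n\times\mathbb{R}^n$ with first marginal $\mathbb{P}_1$ and second marginal $\mathbb{P}_2$. Then the function $\xi_1^\top P\xi_1+\xi_2^\top Q\xi_2+\xi_1^\top R\xi_2$ of $(\xi_1,\xi_2)\in\mathbb{R}^n\times\mathbb{R}^n$ is integrable under every $\pi\in\Pi(\mathbb{P}_1,\mathbb{P}_2)$, and $$\inf_{\pi\in\Pi(\mathbb{P}_1,\mathbb{P}_2)}\int\bigl(\xi_1^\top P\xi_1+\xi_2^\top Q\xi_2+\xi_1^\top R\xi_2\bigr)\,\pi(d\xi_1,d\xi_2) = m_1^\top Pm_1+m_2^\top Qm_2+m_1^\top Rm_2+\operatorname{tr}[PM_1]+\operatorname{tr}[QM_2]-\operatorname{tr}\Bigl[\sqrt{\sqrt{M_1}\,R\,M_2\,R\,\sqrt{M_1}}\Bigr],$$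 where $\sqrt{X}$ denotes the positive semidefinite square root of a symmetric positive semidefinite matrix $X$. -/

import Mathlib

open MeasureTheory ProbabilityTheory Matrix
open scoped MatrixOrder

/-- The set `Π(μ, ν)` of couplings of `μ` and `ν`: probability measures on the product space
whose first marginal is `μ` and whose second marginal is `ν`. -/
def couplings {X Y : Type*} [MeasurableSpace X] [MeasurableSpace Y]
    (μ : Measure X) (ν : Measure Y) : Set (Measure (X × Y)) :=
  {π | IsProbabilityMeasure π ∧ π.map Prod.fst = μ ∧ π.map Prod.snd = ν}

/-- The set of all values `∫ c dπ` of the transport cost over the couplings `π ∈ Π(μ, ν)`.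
The optimal transport value is the infimum of this set. -/
def transportCosts {X Y : Type*} [MeasurableSpace X] [MeasurableSpace Y]
    (μ : Measure X) (ν : Measure Y) (c : X × Y → ℝ) : Set ℝ :=
  {r | ∃ π ∈ couplings μ ν, r = ∫ z, c z ∂π}

/-- The cost `(ξ₁, ξ₂) ↦ ξ₁ᵀ P ξ₁ + ξ₂ᵀ Q ξ₂ + ξ₁ᵀ R ξ₂`. -/
def quadCost {n : ℕ} (P Q R : Matrix (Fin n) (Fin n) ℝ)
    (ξ : EuclideanSpace ℝ (Fin n) × EuclideanSpace ℝ (Fin n)) : ℝ :=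
  ξ.1.ofLp ⬝ᵥ P *ᵥ ξ.1.ofLp + ξ.2.ofLp ⬝ᵥ Q *ᵥ ξ.2.ofLp + ξ.1.ofLp ⬝ᵥ R *ᵥ ξ.2.ofLp

/-! The marginals fix both means and both covariance matrices, so a coupling affects the cost only
through `tr (R C)`, where `C` is its cross-covariance (`integral_quadCost`). Put `A = √M₂ R √M₁`.
The claim is that the least value of `tr (R C)` is `-tr √(AᵀA)`, minus the nuclear norm of `A`.

Lower bound: positivity of the joint covariance forces `C = √M₁ K √M₂` with `K` a contraction, so
`tr (R C) = tr (A K)`. The polar decomposition `A = W √(AᵀA)` then bounds this below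
(`neg_trace_sqrt_le_trace_mul`).

Attainment: `K = -Wᵀ` gives equality. It is realized by driving the two marginals with `Z` and `-W
Z` for one standard Gaussian `Z` (`exists_coupling_crossCov_eq`). Singular covariances are covered
by generalized inverses and by a polar factor that is orthogonal on the whole space. -/

namespace Matrix

/-! ### Generalized inverses, polar decomposition and the trace bound -/

variable {ι : Type*} [Fintype ι] [DecidableEq ι]

lemma transpose_sqrt (M : Matrix ι ι ℝ) : (CFC.sqrt M)ᵀ = CFC.sqrt M := by
  have := (CFC.sqrt_nonneg M).posSemidef.isHermitian
  rwa [IsHermitian, conjTranspose_eq_transpose_of_trivial] at this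

/-- A symmetric real matrix has a symmetric commuting generalized inverse. -/
lemma IsSymm.exists_generalizedInverse {S : Matrix ι ι ℝ} (hS : S.IsSymm) :
    ∃ T : Matrix ι ι ℝ, T.IsSymm ∧ S * T * S = S ∧ T * S = S * T := by
  have hsa : IsSelfAdjoint S := by
    rw [isSelfAdjoint_iff, star_eq_conjTranspose, conjTranspose_eq_transpose_of_trivial, hS]
  have hfin : (spectrum ℝ S).Finite := Matrix.finite_real_spectrum
  have hinv : ContinuousOn (fun x : ℝ ↦ x⁻¹) (spectrum ℝ S) := hfin.continuousOn _
  -- Since `0⁻¹ = 0`, the identity `x * x⁻¹ * x = x` also holds at the eigenvalue `0`.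
  refine ⟨cfc (fun x : ℝ ↦ x⁻¹) S, ?_, ?_, ?_⟩
  · have h : IsSelfAdjoint (cfc (fun x : ℝ ↦ x⁻¹) S) := cfc_predicate _ _
    rwa [isSelfAdjoint_iff, star_eq_conjTranspose, conjTranspose_eq_transpose_of_trivial] at h
  · nth_rw 1 3 [← cfc_id' ℝ S]
    rw [← cfc_mul _ _ S, ← cfc_mul _ _ S]
    conv_rhs => rw [← cfc_id' ℝ S]
    refine cfc_congr fun x _ ↦ ?_
    simp
  · have h := (cfc_commute_cfc (fun x : ℝ ↦ x⁻¹) id S).eq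
    rwa [cfc_id ℝ S] at h

/-- Polar decomposition of a real square matrix, with an orthogonal factor. -/
lemma exists_orthogonal_mul_sqrt (A : Matrix ι ι ℝ) :
    ∃ U : EuclideanSpace ℝ ι ≃ₗᵢ[ℝ] EuclideanSpace ℝ ι, ∃ W : Matrix ι ι ℝ,
      (∀ x, U x = toEuclideanCLM (𝕜 := ℝ) W x) ∧ Wᵀ * W = 1 ∧ A = W * CFC.sqrt (Aᵀ * A) := by
  set N := CFC.sqrt (Aᵀ * A) with hN
  have hpos : (Aᵀ * A).PosSemidef := by
    simpa [conjTranspose_eq_transpose_of_trivial] using posSemidef_conjTranspose_mul_self A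
  have hNN : N * N = Aᵀ * A := CFC.sqrt_mul_sqrt_self _ hpos.nonneg
  have hNs : Nᵀ = N := transpose_sqrt _
  have hnorm (B : Matrix ι ι ℝ) (x : EuclideanSpace ℝ ι) :
      ‖toEuclideanCLM (𝕜 := ℝ) B x‖ ^ 2 = x.ofLp ⬝ᵥ (Bᵀ * B) *ᵥ x.ofLp := by
    rw [EuclideanSpace.real_norm_sq_eq, ← mulVec_mulVec, dotProduct_mulVec, vecMul_transpose,
      dotProduct]
    simp [pow_two]
  have hAN (x : EuclideanSpace ℝ ι) : ‖toEuclideanCLM (𝕜 := ℝ) A x‖ = ‖toEuclideanCLM (𝕜 := ℝ) N x‖ := by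
    rw [← sq_eq_sq₀ (norm_nonneg _) (norm_nonneg _), hnorm, hnorm, hNs, hNN]
  obtain ⟨T, -, hT, -⟩ := IsSymm.exists_generalizedInverse hNs
  have hmul (B C : Matrix ι ι ℝ) (x : EuclideanSpace ℝ ι) : toEuclideanCLM (𝕜 := ℝ) (B * C) x =
      toEuclideanCLM (𝕜 := ℝ) B (toEuclideanCLM (𝕜 := ℝ) C x) := by rw [map_mul]; rfl
  -- `N` kills `(T N - 1) x`, hence so does `A`, because `‖A y‖ = ‖N y‖` for every `y`.
  have hATN (x : EuclideanSpace ℝ ι) : toEuclideanCLM (𝕜 := ℝ) (A * T)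
      (toEuclideanCLM (𝕜 := ℝ) N x) = toEuclideanCLM (𝕜 := ℝ) A x := by
    rw [← hmul, ← sub_eq_zero, ← _root_.sub_apply, ← map_sub,
      show A * T * N - A = A * (T * N - 1) by noncomm_ring, hmul, ← norm_eq_zero, hAN, ← hmul,
      show N * (T * N - 1) = N * T * N - N by noncomm_ring, hT]
    simp
  let V := LinearMap.range (toEuclideanCLM (𝕜 := ℝ) N).toLinearMap
  -- The map `N x ↦ A x` is isometric on the range of `N`; finite dimension lets it extend to an
  -- isometry of the whole space, which is automatically onto.
  let f : V →ₗᵢ[ℝ] EuclideanSpace ℝ ι :=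
    { toLinearMap := (toEuclideanCLM (𝕜 := ℝ) (A * T)).toLinearMap ∘ₗ V.subtype
      norm_map' := by
        rintro ⟨_, x, rfl⟩
        change ‖toEuclideanCLM (𝕜 := ℝ) (A * T) (toEuclideanCLM (𝕜 := ℝ) N x)‖ =
          ‖toEuclideanCLM (𝕜 := ℝ) N x‖
        rw [hATN, hAN] }
  let U := f.extend.toLinearIsometryEquiv rfl
  have hUN (x : EuclideanSpace ℝ ι) :
      U (toEuclideanCLM (𝕜 := ℝ) N x) = toEuclideanCLM (𝕜 := ℝ) A x := by
    rw [LinearIsometry.toLinearIsometryEquiv_apply]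
    exact (f.extend_apply ⟨_, x, rfl⟩).trans (hATN x)
  let W := (toEuclideanCLM (n := ι) (𝕜 := ℝ)).symm f.extend.toContinuousLinearMap
  have hW : toEuclideanCLM (𝕜 := ℝ) W = f.extend.toContinuousLinearMap :=
    StarAlgEquiv.apply_symm_apply _ _
  refine ⟨U, W, fun x ↦ by rw [hW]; rfl, ?_, ?_⟩
  · apply EquivLike.injective (toEuclideanCLM (n := ι) (𝕜 := ℝ))
    rw [map_mul, ← conjTranspose_eq_transpose_of_trivial, ← star_eq_conjTranspose, map_star, hW,
      map_one]
    exact (ContinuousLinearMap.norm_map_iff_adjoint_comp_self _).1 fun x ↦ f.extend.norm_map x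
  · apply EquivLike.injective (toEuclideanCLM (n := ι) (𝕜 := ℝ))
    ext1 x
    rw [hmul, hW]
    exact (hUN x).symm

/-- Factorization of the off-diagonal block of a positive semidefinite block matrix
through square roots of its diagonal blocks, with a contraction in between. -/
lemma exists_contraction_of_block_nonneg {S₁ S₂ C : Matrix ι ι ℝ} (h₁ : S₁.IsSymm)
    (h₂ : S₂.IsSymm)
    (h : ∀ a b : ι → ℝ,
      0 ≤ a ⬝ᵥ (S₁ * S₁) *ᵥ a + 2 * (a ⬝ᵥ C *ᵥ b) + b ⬝ᵥ (S₂ * S₂) *ᵥ b) :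
    ∃ K : Matrix ι ι ℝ, C = S₁ * K * S₂ ∧
      ∀ a b : ι → ℝ, 0 ≤ a ⬝ᵥ a + 2 * (a ⬝ᵥ K *ᵥ b) + b ⬝ᵥ b := by
  obtain ⟨T₁, hT₁, hST₁, hc₁⟩ := h₁.exists_generalizedInverse
  obtain ⟨T₂, hT₂, hST₂, hc₂⟩ := h₂.exists_generalizedInverse
  have hq {S : Matrix ι ι ℝ} (hS : S.IsSymm) (a : ι → ℝ) :
      a ⬝ᵥ (S * S) *ᵥ a = (S *ᵥ a) ⬝ᵥ (S *ᵥ a) := by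
    rw [← mulVec_mulVec, dotProduct_mulVec, ← mulVec_transpose, hS]
  -- An affine function bounded below has zero slope; otherwise the chosen `t` gives the value `-1`.
  have hlin {α β : ℝ} (hαβ : ∀ t : ℝ, 0 ≤ 2 * (t * α) + β) : α = 0 := by
    by_contra hα
    have := hαβ (-(β + 1) / (2 * α))
    have e : 2 * (-(β + 1) / (2 * α) * α) = -(β + 1) := by field_simp
    linarith
  have hleft (a b : ι → ℝ) (ha : S₁ *ᵥ a = 0) : a ⬝ᵥ C *ᵥ b = 0 := by
    refine hlin (β := b ⬝ᵥ (S₂ * S₂) *ᵥ b) fun t ↦ ?_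
    have := h (t • a) b
    rw [hq h₁, mulVec_smul, ha] at this
    simpa using this
  have hright (a b : ι → ℝ) (hb : S₂ *ᵥ b = 0) : a ⬝ᵥ C *ᵥ b = 0 := by
    refine hlin (β := a ⬝ᵥ (S₁ * S₁) *ᵥ a) fun t ↦ ?_
    have := h a (t • b)
    rw [hq h₂, mulVec_smul, mulVec_smul, hb] at this
    simpa [add_comm] using this
  -- `(S₁ T₁ - 1)ᵀ` maps into the kernel of `S₁`, on which the form of `C` vanishes by `hleft`.
  have hC₁ : S₁ * T₁ * C = C := by
    rw [← sub_eq_zero]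
    ext i j
    have e : S₁ * T₁ * C - C = (S₁ * T₁ - 1) * C := by noncomm_ring
    have h0 : S₁ *ᵥ ((S₁ * T₁ - 1)ᵀ *ᵥ Pi.single i 1) = 0 := by
      rw [mulVec_mulVec, transpose_sub, transpose_mul, hT₁, h₁, transpose_one, mul_sub,
        ← Matrix.mul_assoc, hST₁, mul_one, sub_self, zero_mulVec]
    have := hleft _ (Pi.single j 1) h0
    rw [mulVec_transpose, ← dotProduct_mulVec, mulVec_mulVec, ← e] at this
    simpa using this
  have hC₂ : C * (T₂ * S₂) = C := by
    rw [← sub_eq_zero]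
    ext i j
    have e : C * (T₂ * S₂) - C = C * (T₂ * S₂ - 1) := by noncomm_ring
    have h0 : S₂ *ᵥ ((T₂ * S₂ - 1) *ᵥ Pi.single j 1) = 0 := by
      rw [mulVec_mulVec, mul_sub, ← Matrix.mul_assoc, hST₂, mul_one, sub_self, zero_mulVec]
    have := hright (Pi.single i 1) _ h0
    rw [mulVec_mulVec, ← e] at this
    simpa using this
  -- `S T` is a symmetric idempotent, that is, an orthogonal projection, so it does not increase
  -- norms.
  have hcontr {S T : Matrix ι ι ℝ} (hS : S.IsSymm) (hT : T.IsSymm) (hST : S * T * S = S)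
      (hc : T * S = S * T) (a : ι → ℝ) : (T *ᵥ a) ⬝ᵥ (S * S) *ᵥ (T *ᵥ a) ≤ a ⬝ᵥ a := by
    have hE : (S * T) * (S * T) = S * T := by rw [← Matrix.mul_assoc, hST]
    have hEs : (S * T).IsSymm := by rw [IsSymm, transpose_mul, hS, hT, hc]
    have key : a ⬝ᵥ (S * T) *ᵥ a = ((S * T) *ᵥ a) ⬝ᵥ ((S * T) *ᵥ a) := by
      rw [← hq hEs, hE]
    have hpos : 0 ≤ (a - (S * T) *ᵥ a) ⬝ᵥ (a - (S * T) *ᵥ a) :=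
      Finset.sum_nonneg fun i _ ↦ mul_self_nonneg _
    rw [sub_dotProduct, dotProduct_sub, dotProduct_sub, dotProduct_comm ((S * T) *ᵥ a) a] at hpos
    rw [hq hS, mulVec_mulVec]
    linarith
  refine ⟨T₁ * C * T₂, ?_, fun a b ↦ ?_⟩
  · rw [show S₁ * (T₁ * C * T₂) * S₂ = S₁ * T₁ * C * (T₂ * S₂) by noncomm_ring, hC₁, hC₂]
  · have h0 := h (T₁ *ᵥ a) (T₂ *ᵥ b)
    have e : (T₁ *ᵥ a) ⬝ᵥ C *ᵥ (T₂ *ᵥ b) = a ⬝ᵥ (T₁ * C * T₂) *ᵥ b := by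
      rw [← mulVec_mulVec, ← mulVec_mulVec, dotProduct_mulVec a, ← mulVec_transpose, hT₁]
    have := hcontr h₁ hT₁ hST₁ hc₁ a
    have := hcontr h₂ hT₂ hST₂ hc₂ b
    linarith

/-- If the block matrix with diagonal blocks `S₁²`, `S₂²` and off-diagonal block `C` is positive
semidefinite, then `tr (R C)` is at least minus the nuclear norm of `S₂ R S₁`. -/
lemma neg_trace_sqrt_le_trace_mul {S₁ S₂ C : Matrix ι ι ℝ} (R : Matrix ι ι ℝ) (h₁ : S₁.IsSymm)
    (h₂ : S₂.IsSymm)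
    (h : ∀ a b : ι → ℝ,
      0 ≤ a ⬝ᵥ (S₁ * S₁) *ᵥ a + 2 * (a ⬝ᵥ C *ᵥ b) + b ⬝ᵥ (S₂ * S₂) *ᵥ b) :
    -(CFC.sqrt ((S₂ * R * S₁)ᵀ * (S₂ * R * S₁))).trace ≤ (R * C).trace := by
  obtain ⟨K, rfl, hK⟩ := exists_contraction_of_block_nonneg h₁ h₂ h
  obtain ⟨-, W, -, hW, hA⟩ := exists_orthogonal_mul_sqrt (S₂ * R * S₁)
  set N := CFC.sqrt ((S₂ * R * S₁)ᵀ * (S₂ * R * S₁))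
  have hN : 0 ≤ N := CFC.sqrt_nonneg _
  set Q := CFC.sqrt N
  have hQ : Q * Q = N := CFC.sqrt_mul_sqrt_self N hN
  have hQs : Qᵀ = Q := transpose_sqrt _
  -- Cyclicity gives `tr (W N K)`; splitting `N = Q Q` symmetrically allows a comparison with `tr (Q
  -- Q)` one diagonal entry at a time.
  have e : (R * (S₁ * K * S₂)).trace = (Q * (K * W) * Q).trace := by
    rw [show R * (S₁ * K * S₂) = (R * S₁ * K) * S₂ by noncomm_ring, trace_mul_comm,
      show S₂ * (R * S₁ * K) = S₂ * R * S₁ * K by noncomm_ring, hA, ← hQ,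
      trace_mul_comm, show K * (W * (Q * Q)) = (K * W * Q) * Q by noncomm_ring, trace_mul_comm,
      ← Matrix.mul_assoc]
  rw [e, ← hQ, trace, trace, ← Finset.sum_neg_distrib]
  refine Finset.sum_le_sum fun i _ ↦ ?_
  let q : ι → ℝ := Q *ᵥ Pi.single i 1
  have e₁ (B : Matrix ι ι ℝ) : (Q * B * Q).diag i = q ⬝ᵥ B *ᵥ q := by
    have : q ⬝ᵥ B *ᵥ q = Pi.single i 1 ⬝ᵥ (Q * B * Q) *ᵥ Pi.single i 1 := by
      rw [← mulVec_mulVec, ← mulVec_mulVec, dotProduct_mulVec (Pi.single i 1), ← mulVec_transpose,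
        hQs]
    rw [this]
    simp
  have e₂ : (Q * Q).diag i = q ⬝ᵥ q := by simpa using e₁ 1
  have e₃ : (W *ᵥ q) ⬝ᵥ (W *ᵥ q) = q ⬝ᵥ q := by
    rw [dotProduct_mulVec, ← mulVec_transpose, mulVec_mulVec, hW, one_mulVec]
  -- As `W` preserves the norm of `q`, this pair gives `0 ≤ 2 (q ⬝ᵥ q) + 2 (q ⬝ᵥ (K * W) *ᵥ q)`.
  have := hK q (W *ᵥ q)
  rw [e₃, mulVec_mulVec] at this
  rw [e₁, e₂]
  linarith

end Matrix

/-! ### Second moments of random vectors and of Gaussian laws -/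

namespace ProbabilityTheory

variable {Ω ι κ : Type*} [Fintype ι] [Fintype κ] {mΩ : MeasurableSpace Ω} {μ : Measure Ω}

lemma integrable_dotProduct_mulVec [IsFiniteMeasure μ] {X : Ω → ι → ℝ} {Y : Ω → κ → ℝ}
    (hX : ∀ i, MemLp (fun ω ↦ X ω i) 2 μ) (hY : ∀ j, MemLp (fun ω ↦ Y ω j) 2 μ)
    (A : Matrix ι κ ℝ) : Integrable (fun ω ↦ X ω ⬝ᵥ A *ᵥ Y ω) μ := by
  simp only [dotProduct, mulVec, Finset.mul_sum]
  refine integrable_finsetSum _ fun i _ ↦ integrable_finsetSum _ fun j _ ↦ ?_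
  exact ((hX i).integrable_mul ((hY j).const_mul (A i j)))

/-- The expectation of a bilinear form in two square integrable random vectors, in terms of their
means and their cross-covariance. -/
lemma integral_dotProduct_mulVec [IsProbabilityMeasure μ] {X : Ω → ι → ℝ} {Y : Ω → κ → ℝ}
    (hX : ∀ i, MemLp (fun ω ↦ X ω i) 2 μ) (hY : ∀ j, MemLp (fun ω ↦ Y ω j) 2 μ)
    (A : Matrix ι κ ℝ) :
    ∫ ω, X ω ⬝ᵥ A *ᵥ Y ω ∂μ = (fun i ↦ ∫ ω, X ω i ∂μ) ⬝ᵥ A *ᵥ (fun j ↦ ∫ ω, Y ω j ∂μ) +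
      (Aᵀ * Matrix.of fun i j ↦ cov[fun ω ↦ X ω i, fun ω ↦ Y ω j; μ]).trace := by
  have hint (i : ι) (j : κ) : Integrable (fun ω ↦ X ω i * (A i j * Y ω j)) μ :=
    (hX i).integrable_mul ((hY j).const_mul (A i j))
  have hcov (i : ι) (j : κ) : ∫ ω, X ω i * (A i j * Y ω j) ∂μ =
      (∫ ω, X ω i ∂μ) * (A i j * ∫ ω, Y ω j ∂μ) +
        A i j * cov[fun ω ↦ X ω i, fun ω ↦ Y ω j; μ] := by
    rw [covariance_eq_sub (hX i) (hY j)]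
    simp only [Pi.mul_apply, mul_left_comm (_ : ℝ) (A i j), integral_const_mul]
    ring
  simp only [dotProduct, mulVec, Finset.mul_sum]
  rw [integral_finsetSum _ fun i _ ↦ integrable_finsetSum _ fun j _ ↦ hint i j]
  simp only [integral_finsetSum _ fun j _ ↦ hint _ j, hcov, Finset.sum_add_distrib]
  congr 1
  simp only [trace, diag, Matrix.mul_apply, transpose_apply, of_apply]
  exact Finset.sum_comm

lemma dotProduct_covariance_mulVec [IsFiniteMeasure μ] {X : Ω → ι → ℝ} {Y : Ω → κ → ℝ}
    (hX : ∀ i, MemLp (fun ω ↦ X ω i) 2 μ) (hY : ∀ j, MemLp (fun ω ↦ Y ω j) 2 μ)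
    (a : ι → ℝ) (b : κ → ℝ) :
    a ⬝ᵥ (Matrix.of fun i j ↦ cov[fun ω ↦ X ω i, fun ω ↦ Y ω j; μ]) *ᵥ b =
      cov[fun ω ↦ ∑ i, a i * X ω i, fun ω ↦ ∑ j, b j * Y ω j; μ] := by
  rw [covariance_fun_sum_fun_sum (fun i ↦ (hX i).const_mul (a i))
    (fun j ↦ (hY j).const_mul (b j))]
  simp only [dotProduct, mulVec, Finset.mul_sum, of_apply, covariance_const_mul_left,
    covariance_const_mul_right]
  refine Finset.sum_congr rfl fun i _ ↦ Finset.sum_congr rfl fun j _ ↦ ?_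
  ring

/-- The joint covariance matrix of two square integrable random vectors is positive semidefinite. -/
lemma covariance_block_nonneg [IsFiniteMeasure μ] {X : Ω → ι → ℝ} {Y : Ω → κ → ℝ}
    (hX : ∀ i, MemLp (fun ω ↦ X ω i) 2 μ) (hY : ∀ j, MemLp (fun ω ↦ Y ω j) 2 μ)
    (a : ι → ℝ) (b : κ → ℝ) :
    0 ≤ a ⬝ᵥ (Matrix.of fun i j ↦ cov[fun ω ↦ X ω i, fun ω ↦ X ω j; μ]) *ᵥ a +
      2 * (a ⬝ᵥ (Matrix.of fun i j ↦ cov[fun ω ↦ X ω i, fun ω ↦ Y ω j; μ]) *ᵥ b) +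
      b ⬝ᵥ (Matrix.of fun i j ↦ cov[fun ω ↦ Y ω i, fun ω ↦ Y ω j; μ]) *ᵥ b := by
  rw [dotProduct_covariance_mulVec hX hX, dotProduct_covariance_mulVec hX hY,
    dotProduct_covariance_mulVec hY hY]
  have hU : MemLp (fun ω ↦ ∑ i, a i * X ω i) 2 μ :=
    memLp_finsetSum _ fun i _ ↦ (hX i).const_mul (a i)
  have hV : MemLp (fun ω ↦ ∑ j, b j * Y ω j) 2 μ :=
    memLp_finsetSum _ fun j _ ↦ (hY j).const_mul (b j)
  -- The block quadratic form at `(a, b)` is the variance of `aᵀX + bᵀY`.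
  have := variance_nonneg ((fun ω ↦ ∑ i, a i * X ω i) + fun ω ↦ ∑ j, b j * Y ω j) μ
  rw [variance_add hU hV, ← covariance_self hU.aemeasurable, ← covariance_self hV.aemeasurable]
    at this
  exact this

variable [DecidableEq ι] {X : Ω → EuclideanSpace ℝ ι} {m : EuclideanSpace ℝ ι} {M : Matrix ι ι ℝ}

lemma memLp_eval_of_map_eq_multivariateGaussian (hX : Measurable X)
    (h : μ.map X = multivariateGaussian m M) (i : ι) : MemLp (fun ω ↦ X ω i) 2 μ := by
  have h1 : MemLp id 2 (μ.map X) := h ▸ IsGaussian.memLp_two_id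
  have h2 : MemLp X 2 μ := h1.comp_of_map hX.aemeasurable
  exact (EuclideanSpace.proj (𝕜 := ℝ) i).comp_memLp' h2

lemma integral_eval_of_map_eq_multivariateGaussian (hX : Measurable X)
    (h : μ.map X = multivariateGaussian m M) (i : ι) : ∫ ω, X ω i ∂μ = m i := by
  have h1 : ∫ x, x i ∂(μ.map X) = m i := by
    rw [h]
    have := (EuclideanSpace.proj (𝕜 := ℝ) i).integral_comp_id_comm
      (IsGaussian.integrable_id (μ := multivariateGaussian m M))
    simpa using this
  rwa [integral_map hX.aemeasurable (by fun_prop)] at h1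

lemma covariance_eval_of_map_eq_multivariateGaussian (hM : M.PosSemidef) (hX : Measurable X)
    (h : μ.map X = multivariateGaussian m M) (i j : ι) :
    cov[fun ω ↦ X ω i, fun ω ↦ X ω j; μ] = M i j := by
  rw [← covariance_eval_multivariateGaussian (μ := m) hM i j, ← h,
    covariance_map_fun (by fun_prop) (by fun_prop) hX.aemeasurable]

end ProbabilityTheory

/-! ### Couplings of two Gaussian measures -/

section Coupling

variable {n : ℕ} {m₁ m₂ : EuclideanSpace ℝ (Fin n)} {M₁ M₂ : Matrix (Fin n) (Fin n) ℝ}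
  {π : Measure (EuclideanSpace ℝ (Fin n) × EuclideanSpace ℝ (Fin n))}

/-- The cross-covariance matrix of a measure on `ℝⁿ × ℝⁿ`. -/
noncomputable def crossCov
    (π : Measure (EuclideanSpace ℝ (Fin n) × EuclideanSpace ℝ (Fin n))) :
    Matrix (Fin n) (Fin n) ℝ :=
  Matrix.of fun i j ↦ cov[fun z ↦ z.1 i, fun z ↦ z.2 j; π]

lemma integrable_quadCost
    (hπ : π ∈ couplings (multivariateGaussian m₁ M₁) (multivariateGaussian m₂ M₂))
    (P Q R : Matrix (Fin n) (Fin n) ℝ) : Integrable (quadCost P Q R) π := by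
  obtain ⟨_, h₁, h₂⟩ := hπ
  have hX := memLp_eval_of_map_eq_multivariateGaussian measurable_fst h₁
  have hY := memLp_eval_of_map_eq_multivariateGaussian measurable_snd h₂
  exact ((integrable_dotProduct_mulVec hX hX P).add (integrable_dotProduct_mulVec hY hY Q)).add
    (integrable_dotProduct_mulVec hX hY R)

/-- Only the mixed term sees more of `π` than its marginals; symmetry of the three matrices removes
the transposes from the trace terms. -/
lemma integral_quadCost (hM₁ : M₁.PosSemidef) (hM₂ : M₂.PosSemidef)
    (hπ : π ∈ couplings (multivariateGaussian m₁ M₁) (multivariateGaussian m₂ M₂))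
    {P Q R : Matrix (Fin n) (Fin n) ℝ} (hP : P.IsSymm) (hQ : Q.IsSymm) (hR : R.IsSymm) :
    ∫ z, quadCost P Q R z ∂π =
      m₁.ofLp ⬝ᵥ P *ᵥ m₁.ofLp + m₂.ofLp ⬝ᵥ Q *ᵥ m₂.ofLp + m₁.ofLp ⬝ᵥ R *ᵥ m₂.ofLp
        + (P * M₁).trace + (Q * M₂).trace + (R * crossCov π).trace := by
  obtain ⟨_, h₁, h₂⟩ := hπ
  have hX := memLp_eval_of_map_eq_multivariateGaussian measurable_fst h₁
  have hY := memLp_eval_of_map_eq_multivariateGaussian measurable_snd h₂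
  have iP := integrable_dotProduct_mulVec hX hX P
  have iQ := integrable_dotProduct_mulVec hY hY Q
  have iR := integrable_dotProduct_mulVec hX hY R
  simp only [quadCost]
  rw [integral_add (by exact iP.add iQ) iR, integral_add iP iQ, integral_dotProduct_mulVec hX hX,
    integral_dotProduct_mulVec hY hY, integral_dotProduct_mulVec hX hY, hP, hQ, hR]
  simp only [integral_eval_of_map_eq_multivariateGaussian measurable_fst h₁,
    integral_eval_of_map_eq_multivariateGaussian measurable_snd h₂,
    covariance_eval_of_map_eq_multivariateGaussian hM₁ measurable_fst h₁,
    covariance_eval_of_map_eq_multivariateGaussian hM₂ measurable_snd h₂]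
  change _ + (P * M₁).trace + (_ + (Q * M₂).trace) + (_ + (R * crossCov π).trace) = _
  ring

lemma crossCov_block_nonneg (hM₁ : M₁.PosSemidef) (hM₂ : M₂.PosSemidef)
    (hπ : π ∈ couplings (multivariateGaussian m₁ M₁) (multivariateGaussian m₂ M₂))
    (a b : Fin n → ℝ) :
    0 ≤ a ⬝ᵥ M₁ *ᵥ a + 2 * (a ⬝ᵥ crossCov π *ᵥ b) + b ⬝ᵥ M₂ *ᵥ b := by
  obtain ⟨_, h₁, h₂⟩ := hπ
  have := covariance_block_nonneg (memLp_eval_of_map_eq_multivariateGaussian measurable_fst h₁)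
    (memLp_eval_of_map_eq_multivariateGaussian measurable_snd h₂) a b
  simp only [covariance_eval_of_map_eq_multivariateGaussian hM₁ measurable_fst h₁,
    covariance_eval_of_map_eq_multivariateGaussian hM₂ measurable_snd h₂] at this
  exact this

/-- Two Gaussian measures have a coupling with cross-covariance `√M₁ Wᵀ √M₂` for each orthogonal
matrix `W`: the joint law of `m₁ + √M₁ Z` and `m₂ + √M₂ W Z` with `Z` standard Gaussian. -/
lemma exists_coupling_crossCov_eq (m₁ m₂ : EuclideanSpace ℝ (Fin n))
    (U : EuclideanSpace ℝ (Fin n) ≃ₗᵢ[ℝ] EuclideanSpace ℝ (Fin n)) {W : Matrix (Fin n) (Fin n) ℝ}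
    (hU : ∀ x, U x = toEuclideanCLM (𝕜 := ℝ) W x) :
    ∃ π ∈ couplings (multivariateGaussian m₁ M₁) (multivariateGaussian m₂ M₂),
      crossCov π = CFC.sqrt M₁ * Wᵀ * CFC.sqrt M₂ := by
  set S₁ := CFC.sqrt M₁
  set S₂ := CFC.sqrt M₂
  have hS₂s : S₂ᵀ = S₂ := transpose_sqrt M₂
  let f (x : EuclideanSpace ℝ (Fin n)) := m₁ + toEuclideanCLM (𝕜 := ℝ) S₁ x
  let g (x : EuclideanSpace ℝ (Fin n)) := m₂ + toEuclideanCLM (𝕜 := ℝ) S₂ (U x)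
  have hf : Measurable f := by fun_prop
  have hg : Measurable g := by fun_prop
  let γ := stdGaussian (EuclideanSpace ℝ (Fin n))
  refine ⟨γ.map fun x ↦ (f x, g x), ⟨Measure.isProbabilityMeasure_map (by fun_prop), ?_, ?_⟩, ?_⟩
  · rw [Measure.map_map (by fun_prop) (by fun_prop)]
    rfl
  -- The standard Gaussian is invariant under the isometry `U`, so `U` leaves the second marginal
  -- unchanged.
  · rw [Measure.map_map (by fun_prop) (by fun_prop), multivariateGaussian, ← stdGaussian_map U,
      Measure.map_map (by fun_prop) (by fun_prop)]
    rfl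
  · ext i j
    rw [crossCov, of_apply, covariance_map_fun (by fun_prop) (by fun_prop) (by fun_prop)]
    have hL (k : Fin n) : MemLp (fun x : EuclideanSpace ℝ (Fin n) ↦ x k) 2 γ :=
      (EuclideanSpace.proj (𝕜 := ℝ) k).comp_memLp' IsGaussian.memLp_two_id
    have hcov (k l : Fin n) : cov[fun x : EuclideanSpace ℝ (Fin n) ↦ x k,
        fun x : EuclideanSpace ℝ (Fin n) ↦ x l; γ] = (1 : Matrix (Fin n) (Fin n) ℝ) k l := by
      rw [← covariance_eval_multivariateGaussian (μ := 0) PosSemidef.one,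
        multivariateGaussian_zero_one]
    have e₁ (x : EuclideanSpace ℝ (Fin n)) : f x i = m₁ i + ∑ k, S₁ i k * x k := rfl
    have e₂ (x : EuclideanSpace ℝ (Fin n)) : g x j = m₂ j + ∑ k, (S₂ * W) j k * x k := by
      have : g x = m₂ + toEuclideanCLM (𝕜 := ℝ) (S₂ * W) x := by
        simp only [g, hU, map_mul]
        rfl
      rw [this]
      rfl
    simp only [e₁, e₂]
    rw [covariance_const_add_left, covariance_const_add_right, covariance_fun_sum_fun_sum
      (fun k ↦ (hL k).const_mul _) (fun k ↦ (hL k).const_mul _)]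
    · simp only [covariance_const_mul_left, covariance_const_mul_right, hcov]
      rw [Matrix.mul_assoc, ← hS₂s, ← transpose_mul, hS₂s, Matrix.mul_apply]
      simp [one_apply, mul_comm]
    · exact (memLp_finsetSum _ fun k _ ↦ (hL k).const_mul _).integrable one_le_two
    · exact (memLp_finsetSum _ fun k _ ↦ (hL k).const_mul _).integrable one_le_two

end Coupling

theorem corollary1 (n : ℕ) (m₁ m₂ : EuclideanSpace ℝ (Fin n))
    (M₁ M₂ P Q R : Matrix (Fin n) (Fin n) ℝ)
    (hM₁ : M₁.PosSemidef) (hM₂ : M₂.PosSemidef)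
    (hP : P.IsSymm) (hQ : Q.IsSymm) (hR : R.IsSymm) :
    (∀ π ∈ couplings (multivariateGaussian m₁ M₁) (multivariateGaussian m₂ M₂),
      Integrable (quadCost P Q R) π) ∧
    IsGLB
      (transportCosts (multivariateGaussian m₁ M₁) (multivariateGaussian m₂ M₂) (quadCost P Q R))
      (m₁.ofLp ⬝ᵥ P *ᵥ m₁.ofLp + m₂.ofLp ⬝ᵥ Q *ᵥ m₂.ofLp + m₁.ofLp ⬝ᵥ R *ᵥ m₂.ofLp
        + (P * M₁).trace + (Q * M₂).trace
        - (CFC.sqrt (CFC.sqrt M₁ * R * M₂ * R * CFC.sqrt M₁)).trace) := by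
  -- The infimum is attained.
  refine ⟨fun π hπ ↦ integrable_quadCost hπ P Q R, IsLeast.isGLB ?_⟩
  have hS₁ := CFC.sqrt_mul_sqrt_self M₁ hM₁.nonneg
  have hS₂ := CFC.sqrt_mul_sqrt_self M₂ hM₂.nonneg
  have hA : CFC.sqrt M₁ * R * M₂ * R * CFC.sqrt M₁ =
      (CFC.sqrt M₂ * R * CFC.sqrt M₁)ᵀ * (CFC.sqrt M₂ * R * CFC.sqrt M₁) := by
    rw [transpose_mul, transpose_mul, transpose_sqrt, transpose_sqrt, hR]
    nth_rw 1 [← hS₂]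
    noncomm_ring
  rw [hA]
  constructor
  · obtain ⟨U, W, hU, hW, hpolar⟩ :=
      exists_orthogonal_mul_sqrt (CFC.sqrt M₂ * R * CFC.sqrt M₁)
    -- The sign of the polar factor is flipped, so that `tr (R C)` becomes `-tr (Wᵀ A)`.
    obtain ⟨π, hπ, hC⟩ := exists_coupling_crossCov_eq (M₁ := M₁) (M₂ := M₂) m₁ m₂
      (U.trans (LinearIsometryEquiv.neg ℝ)) (W := -W) (fun x ↦ by simp [hU])
    refine ⟨π, hπ, ?_⟩
    rw [integral_quadCost hM₁ hM₂ hπ hP hQ hR, hC, sub_eq_add_neg]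
    congr 1
    have htr : (R * (CFC.sqrt M₁ * Wᵀ * CFC.sqrt M₂)).trace =
        (Wᵀ * (CFC.sqrt M₂ * R * CFC.sqrt M₁)).trace := by
      rw [trace_mul_comm Wᵀ, trace_mul_comm R, Matrix.mul_assoc, trace_mul_comm]
      simp only [Matrix.mul_assoc]
    rw [transpose_neg, mul_neg, neg_mul, mul_neg, trace_neg, htr]
    -- Orthogonality of `W` turns `A = W √(AᵀA)` into `Wᵀ A = √(AᵀA)`.
    have hWA := congrArg (Wᵀ * ·) hpolar
    simp only [← Matrix.mul_assoc Wᵀ W, hW, Matrix.one_mul] at hWA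
    rw [hWA]
  · rintro _ ⟨π, hπ, rfl⟩
    rw [integral_quadCost hM₁ hM₂ hπ hP hQ hR, sub_eq_add_neg]
    refine add_le_add_right (neg_trace_sqrt_le_trace_mul R (transpose_sqrt M₁) (transpose_sqrt M₂) ?_) _
    rw [hS₁, hS₂]
    exact crossCov_block_nonneg hM₁ hM₂ hπ
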